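/- **Setting.** Let $\Gamma\ge 1$, $\Lambda\ge 2$ be integers, $\kappa\ge 1$ real, $k=\lfloor\kappa\rfloor$, $K=\lceil\kappa\rceil$, $N=K\Lambda^{k}$. For $|j|\le N$ put $\phi_j=\lfloor |j|/\Lambda^{k-1}\rfloor+1$ and $\phi'_j=\min\{\phi_j,\max(1,\lceil K\Lambda^{\kappa}\rceil-\sum_{|j|<j'\le N}\phi_{j'})\}$. The network $G=G(\Gamma,\kappa,\Lambda)$ has the following nodes: for $1\le x\le k$ the highway nodes $h^x_a$, where $a$ is a multiple of $\Lambda^{k-x}$ with $|a|\le N$; for $1\le i\le\Gamma$, $|j|\le N$ and $1\le m\le\phi'_j$ the path nodes $v^i_{j,m}$; and two nodes $s,t$. Its highway edges join $h^x_a$ to $h^x_{a+\Lambda^{k-x}}$; each has one copy. Its other edges have infinitely many copies and join: $h^x_a$ to $h^{x+1}_a$; $v^i_{j,m}$ to $v^i_{j,m+1}$; $v^i_{j,\phi'_j}$ to $v^i_{j+1,1}$ and $v^i_{-j,\phi'_{-j}}$ to $v^i_{-(j+1),1}$ for $j\ge0$; $h^k_j$ to $v^i_{j,1}$; the leftmost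 nodes $v^i_{-N,\phi'_{-N}}$ of the paths to each other and to $s$; the rightmost nodes $v^i_{N,\phi'_N}$ of the paths to each other and to $t$. Let $n$ be the number of nodes of $G$; $\log$ is to base $2$. Let $b$ be a natural number, $f:\{0,1\}^b\times\{0,1\}^b\to\mathbb R$ and $\epsilon\ge0$. In both models below all parties share an infinite string of independent fair random bits, and a computation is $\epsilon$-error if on every input $(\bar x,\bar y)$ its output is $f(\bar x,\bar y)$ with probability at least $1-\epsilon$. *Algorithms on $G$:* initially $s$ holds $\bar x$ and $t$ holds $\bar y$; computation proceeds in synchronous rounds with unlimited local computation; in each round $\lfloor\log n\rfloor$ bits can be sent in each direction over each copy of each edge; at the end $t$ outputs. Let $R^{G,s,t}_\epsilon(f)$ be the least number of rounds of an $\epsilon$-error algorithm for $f$. *Direct protocols:* Alice holds $\bar x$ and Bob holds $\bar y$; in each round Alice sends Bob a (self-delimiting) bit string of any length and then Bob sends one to Alice; at the end Bob outputs. Let $R^{q\text{-cc-pub}}_\epsilon(f)$ be the least worst-case total number of bits exchanged in an $\epsilon$-error protocol for $f$ with at most $q$ rounds. **Theorem.** Let $r$ be a natural number with $r\le\kappa\Lambda^\kappa$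 such that some $\epsilon$-error algorithm computes $f$ on $G(\Gamma,\kappa,\Lambda)$ in $r$ rounds. Then there is an $\epsilon$-error public-coin direct protocol for $f$ with at most $\frac{8r}{\kappa\Lambda}$ rounds in which, for all inputs and all random strings, at most $(2\kappa\log n)\,r$ bits are exchanged in total. In particular this holds for $r=R^{G,s,t}_\epsilon(f)$ if this is at most $\kappa\Lambda^\kappa$, and then $$R_\epsilon^{\frac{8r}{\kappa\Lambda}\text{-cc-pub}}(f)\le(2\kappa\log n)\,r .$$ -/

import Mathlib

open MeasureTheory
open scoped ENNReal

namespace BoundedRound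

/-- The `b`-bit strings. -/
abbrev Bits (b : ℕ) : Type := Fin b → Bool

/-- The shared random bit string of infinite length. -/
abbrev Coins : Type := ℕ → Bool

/-- The law of infinitely many independent fair bits. -/
noncomputable def coinMeasure : Measure Coins :=
  Measure.infinitePi fun _ : ℕ => (PMF.uniformOfFintype Bool).toMeasure

/-- A public-coin procedure whose output on the inputs `x`, `y` with coins `ω` is `out ω x y`
computes `f` with error `ε`: on every input the output is right with probability at least
`1 - ε`. -/
def IsErrorAtMost {b : ℕ} (ε : ℝ) (f : Bits b → Bits b → ℝ)
    (out : Coins → Bits b → Bits b → ℝ) : Prop :=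
  ∀ x y : Bits b, MeasurableSet {ω : Coins | out ω x y = f x y} ∧
    ENNReal.ofReal (1 - ε) ≤ coinMeasure {ω : Coins | out ω x y = f x y}

section Direct

/-- A public-coin protocol for direct communication between Alice (input `x`) and Bob (input `y`).
In each round Alice sends a bit string to Bob, and then Bob sends a bit string to Alice. A message
depends on the coins, on the sender's input and on the transcript, which is the list of all messages
sent so far. As in a protocol tree, the messages are self-delimiting: after a given transcript, no
possible message is a proper prefix of another one. At the end Bob produces the output. -/
structure Protocol (b : ℕ) where
  rounds : ℕ
  alice : Coins → Bits b → List (List Bool) → List Bool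
  bob : Coins → Bits b → List (List Bool) → List Bool
  output : Coins → Bits b → List (List Bool) → ℝ
  alice_prefix : ∀ (ω : Coins) (tr : List (List Bool)) (x x' : Bits b),
    alice ω x tr <+: alice ω x' tr → alice ω x tr = alice ω x' tr
  bob_prefix : ∀ (ω : Coins) (tr : List (List Bool)) (y y' : Bits b),
    bob ω y tr <+: bob ω y' tr → bob ω y tr = bob ω y' tr

variable {b : ℕ}

/-- The transcript after `i` rounds. -/
def Protocol.transcript (P : Protocol b) (ω : Coins) (x y : Bits b) : ℕ → List (List Bool)
  | 0 => []
  | i + 1 =>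
    let tr := P.transcript ω x y i
    let a := P.alice ω x tr
    tr ++ [a, P.bob ω y (tr ++ [a])]

/-- The total number of bits exchanged. -/
def Protocol.bits (P : Protocol b) (ω : Coins) (x y : Bits b) : ℕ :=
  ((P.transcript ω x y P.rounds).map List.length).sum

/-- Bob's output at the end of the protocol. -/
def Protocol.result (P : Protocol b) (ω : Coins) (x y : Bits b) : ℝ :=
  P.output ω y (P.transcript ω x y P.rounds)

/-- `R_ε^{q-cc-pub}(f)`: the least number of bits that suffices, for all inputs and coins, in an
`ε`-error public-coin protocol for `f` with at most `q` rounds (`⊤` if there is none). -/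
noncomputable def ccComplexity (q ε : ℝ) (f : Bits b → Bits b → ℝ) : ℕ∞ :=
  ⨅ c ∈ {c : ℕ | ∃ P : Protocol b, (P.rounds : ℝ) ≤ q ∧ IsErrorAtMost ε f P.result ∧
    ∀ ω x y, P.bits ω x y ≤ c}, (c : ℕ∞)

end Direct

section Distributed

/-- A network with two distinguished nodes `s` and `t`; `copies u v` is the number of copies of the
edge `uv`, where `0` means that there is no edge and `⊤` that there are infinitely many copies. -/
structure Network where
  V : Type
  copies : V → V → ℕ∞
  s : V
  t : V

/-- The number of nodes, called `n`. -/
noncomputable def Network.size (G : Network) : ℕ := Nat.card G.V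

/-- What `u` can send to its neighbour `v` in one round: `⌊log₂ n⌋` bits over each copy of the
edge. -/
abbrev Network.Msg (G : Network) (u v : G.V) : Type :=
  {c : ℕ // (c : ℕ∞) < G.copies u v} → Fin (Nat.log 2 G.size) → Bool

/-- The input known to a node: `s` holds `x`, `t` holds `y`, and the other nodes hold nothing. -/
noncomputable def Network.localInput (G : Network) {b : ℕ} (x y : Bits b) (v : G.V) :
    Option (Bits b) := by
  classical exact if v = G.s then some x else if v = G.t then some y else none

/-- A synchronous public-coin distributed algorithm. A node starts in a state that depends on the
coins and on its own input. In each round it sends over each incident edge a message determined by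
its state, and then updates its state from the messages that it receives. Local computation is
unrestricted. The node `t` produces the output. -/
structure DistAlgorithm (G : Network) (b : ℕ) where
  State : G.V → Type
  init : Coins → (v : G.V) → Option (Bits b) → State v
  send : (u v : G.V) → State u → G.Msg u v
  step : (v : G.V) → State v → ((u : G.V) → G.Msg u v) → State v
  output : State G.t → ℝ

variable {G : Network} {b : ℕ}

/-- The states of all nodes after a number of rounds. -/
noncomputable def DistAlgorithm.run (A : DistAlgorithm G b) (ω : Coins) (x y : Bits b) :
    ℕ → (v : G.V) → A.State v
  | 0 => fun v => A.init ω v (G.localInput x y v)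
  | τ + 1 => fun v =>
    A.step v (A.run ω x y τ v) fun u => A.send u v (A.run ω x y τ u)

/-- The output of `t` after `T` rounds. -/
noncomputable def DistAlgorithm.result (A : DistAlgorithm G b) (T : ℕ) (ω : Coins) (x y : Bits b) :
    ℝ :=
  A.output (A.run ω x y T G.t)

/-- `R_ε^{G,s,t}(f)`: the least number of rounds in which some `ε`-error algorithm computes `f`
on `G` (`⊤` if there is none). -/
noncomputable def distComplexity (G : Network) (ε : ℝ) (f : Bits b → Bits b → ℝ) : ℕ∞ :=
  ⨅ T ∈ {T : ℕ | ∃ A : DistAlgorithm G b, IsErrorAtMost ε f (A.result T)}, (T : ℕ∞)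

end Distributed

section Construction

/-- `⌈κ⌉ Λ^⌊κ⌋`, the largest subscript. -/
noncomputable def maxIndex (κ : ℝ) (Λ : ℕ) : ℕ := ⌈κ⌉₊ * Λ ^ ⌊κ⌋₊

/-- `φ_j = ⌊|j| / Λ^(⌊κ⌋-1)⌋ + 1`. -/
noncomputable def phi (κ : ℝ) (Λ : ℕ) (j : ℤ) : ℕ := j.natAbs / Λ ^ (⌊κ⌋₊ - 1) + 1

/-- `φ'_j = min {φ_j, max (1, ⌈⌈κ⌉ Λ^κ⌉ - ∑_{j' > |j|} φ_{j'})}`, where `j'` ranges over the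
subscripts in use. The truncation of the subtraction has no effect because of the maximum. -/
noncomputable def phi' (κ : ℝ) (Λ : ℕ) (j : ℤ) : ℕ :=
  min (phi κ Λ j)
    (max 1 (⌈(⌈κ⌉₊ : ℝ) * (Λ : ℝ) ^ κ⌉₊ -
      ∑ j' ∈ Finset.Ioc j.natAbs (maxIndex κ Λ), phi κ Λ (j' : ℤ)))

/-- Names of nodes: `h x a` is the node with subscript `a` on the `x`-th highway, and `v i j m` is
the `m`-th node of the `j`-th subpath of the `i`-th path. -/
inductive Label : Type
  | h (x : ℕ) (a : ℤ)
  | v (i : ℕ) (j : ℤ) (m : ℕ)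
  | s
  | t

/-- The names that occur in `G(Γ, κ, Λ)`. The `x`-th highway, `1 ≤ x ≤ ⌊κ⌋`, consists of the
`2 ⌈κ⌉ Λ^x + 1` multiples `a` of `Λ^(⌊κ⌋-x)` with `|a| ≤ ⌈κ⌉ Λ^⌊κ⌋`. The `j`-th subpath of each of
the `Γ` paths has `φ'_j` nodes. -/
def IsNode (Γ : ℕ) (κ : ℝ) (Λ : ℕ) : Label → Prop
  | .h x a => 1 ≤ x ∧ x ≤ ⌊κ⌋₊ ∧ ((Λ : ℤ) ^ (⌊κ⌋₊ - x) ∣ a) ∧ a.natAbs ≤ maxIndex κ Λ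
  | .v i j m => 1 ≤ i ∧ i ≤ Γ ∧ j.natAbs ≤ maxIndex κ Λ ∧ 1 ≤ m ∧ m ≤ phi' κ Λ j
  | .s => True
  | .t => True

/-- The edges of the highways (in one orientation). -/
inductive HighwayEdge (κ : ℝ) (Λ : ℕ) : Label → Label → Prop
  | mk (x : ℕ) (a : ℤ) : HighwayEdge κ Λ (.h x a) (.h x (a + (Λ : ℤ) ^ (⌊κ⌋₊ - x)))

/-- The name of the leftmost node of the `i`-th path. -/
noncomputable def leftEnd (κ : ℝ) (Λ : ℕ) (i : ℕ) : Label :=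
  .v i (-(maxIndex κ Λ : ℤ)) (phi' κ Λ (-(maxIndex κ Λ : ℤ)))

/-- The name of the rightmost node of the `i`-th path. -/
noncomputable def rightEnd (κ : ℝ) (Λ : ℕ) (i : ℕ) : Label :=
  .v i (maxIndex κ Λ : ℤ) (phi' κ Λ (maxIndex κ Λ : ℤ))

/-- All the other edges (in one orientation). -/
inductive OtherEdge (κ : ℝ) (Λ : ℕ) : Label → Label → Prop
  /-- between consecutive highways, at equal subscripts -/
  | rung (x : ℕ) (a : ℤ) : OtherEdge κ Λ (.h x a) (.h (x + 1) a)
  /-- inside a subpath -/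
  | inner (i : ℕ) (j : ℤ) (m : ℕ) : OtherEdge κ Λ (.v i j m) (.v i j (m + 1))
  /-- from a subpath to the next one, outwards on the right side -/
  | outRight (i : ℕ) (j : ℕ) :
      OtherEdge κ Λ (.v i (j : ℤ) (phi' κ Λ (j : ℤ))) (.v i ((j : ℤ) + 1) 1)
  /-- from a subpath to the next one, outwards on the left side -/
  | outLeft (i : ℕ) (j : ℕ) :
      OtherEdge κ Λ (.v i (-(j : ℤ)) (phi' κ Λ (-(j : ℤ)))) (.v i (-((j : ℤ) + 1)) 1)
  /-- between the leftmost nodes of two paths -/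
  | leftEnds (i i' : ℕ) (hne : i ≠ i') : OtherEdge κ Λ (leftEnd κ Λ i) (leftEnd κ Λ i')
  /-- between the rightmost nodes of two paths -/
  | rightEnds (i i' : ℕ) (hne : i ≠ i') : OtherEdge κ Λ (rightEnd κ Λ i) (rightEnd κ Λ i')
  /-- from the last highway to the paths -/
  | ramp (i : ℕ) (j : ℤ) : OtherEdge κ Λ (.h ⌊κ⌋₊ j) (.v i j 1)
  | source (i : ℕ) : OtherEdge κ Λ .s (leftEnd κ Λ i)
  | target (i : ℕ) : OtherEdge κ Λ .t (rightEnd κ Λ i)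

open Classical in
/-- The network `G(Γ, κ, Λ)`: the highway edges have one copy, all other edges have infinitely many
copies. -/
noncomputable def networkG (Γ : ℕ) (κ : ℝ) (Λ : ℕ) : Network where
  V := {l : Label // IsNode Γ κ Λ l}
  copies u w :=
    if HighwayEdge κ Λ u.1 w.1 ∨ HighwayEdge κ Λ w.1 u.1 then 1
    else if OtherEdge κ Λ u.1 w.1 ∨ OtherEdge κ Λ w.1 u.1 then ⊤
    else 0
  s := ⟨.s, trivial⟩
  t := ⟨.t, trivial⟩

/-- The network is finite, so that `Network.size` is the number of its nodes. -/
theorem finite_networkG (Γ : ℕ) (κ : ℝ) (Λ : ℕ) : Finite (networkG Γ κ Λ).V := by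
  let N := maxIndex κ Λ
  let S : Set Label :=
    (fun p : ℕ × ℤ => Label.h p.1 p.2) '' (Set.Icc 1 ⌊κ⌋₊ ×ˢ Set.Icc (-(N : ℤ)) N) ∪
    (fun p : ℕ × ℤ × ℕ => Label.v p.1 p.2.1 p.2.2) ''
      (Set.Icc 1 Γ ×ˢ Set.Icc (-(N : ℤ)) N ×ˢ Set.Icc 1 (N + 1)) ∪ {Label.s, Label.t}
  have hS : S.Finite := by
    refine ((Set.Finite.image _ ?_).union (Set.Finite.image _ ?_)).union (Set.toFinite _)
    · exact (Set.finite_Icc _ _).prod (Set.finite_Icc _ _)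
    · exact (Set.finite_Icc _ _).prod ((Set.finite_Icc _ _).prod (Set.finite_Icc _ _))
  refine Set.Finite.to_subtype (s := {l : Label | IsNode Γ κ Λ l}) (hS.subset ?_)
  rintro (⟨x, a⟩ | ⟨i, j, m⟩ | _ | _) hl
  · obtain ⟨h1, h2, -, h4⟩ := hl
    refine Or.inl (Or.inl ⟨(x, a), ⟨⟨h1, h2⟩, ?_⟩, rfl⟩)
    simp only [Set.mem_Icc, N]
    omega
  · obtain ⟨h1, h2, h3, h4, h5⟩ := hl
    have h6 : phi' κ Λ j ≤ j.natAbs + 1 :=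
      (min_le_left _ _).trans (Nat.add_le_add_right (Nat.div_le_self _ _) 1)
    refine Or.inl (Or.inr ⟨(i, j, m), ⟨⟨h1, h2⟩, ?_, ?_⟩, rfl⟩)
    · simp only [Set.mem_Icc, N]
      omega
    · simp only [Set.mem_Icc, N]
      omega
  · exact Or.inr (Or.inl rfl)
  · exact Or.inr (Or.inr rfl)

end Construction

end BoundedRound

open BoundedRound

/-!
The protocol simulates the network from its two ends. At time `τ` Alice knows the states of the
nodes `v` with `τ < clock v`, where the clock grows from `t` inwards by one per node of a path and
takes equal values at all highway nodes of the same subscript; Bob uses the mirror image. Along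
edges of infinite capacity the clock changes by at most one (`clock_sub_le_of_otherEdge`), so these
never carry information across the cut. On each highway at most one edge crosses the cut in a given
round (`isLaneCut_clock`), so `⌊κ⌋ ⌊log n⌋` bits per round and direction suffice.

To save rounds of communication, these bits are sent in blocks, one block for the time that the cut
needs to pass one subpath. In the block of the subpath `α = N - i`, Alice has to know in advance what
enters the region known to Bob, whose border stays at positions below `0`. Without help from Bob, she
can follow a node there for as many rounds as it has hops to the position `α`. A hop covers at most
`Λ^(k-1)` positions, so there are at least `⌊α / Λ^(k-1)⌋ + 1 = φ_α` hops, which is no less than the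
length `φ'_α` of the block (`phi'_le_hops`). Hence the number of rounds of communication is the number `m`
of subpaths that the cut passes completely in time `r`. Since all of them but possibly the last have
full length and `φ` is at least `K Λ / 2` on average, `m K Λ ≤ 4 r` (`mul_le_four_mul_tail`). As
`r` does not exceed the budget `⌈K Λ^κ⌉`, which is less than the number of nodes on one half of a
path, the cut does not reach the middle (`budget_lt_tail_zero`).

That a message can be computed by its sender is proved by comparing runs: two inputs that agree for
the sender and have led to the same received messages yield the same states in the region known to
the sender (`DistAlgorithm.run_eq_of_blockMsg_eq`). Such messages form a protocol
(`exists_protocol`), since the sender may pick any input of the other party that is consistent with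
the transcript.
-/

namespace BoundedRound

/-! ### Direct protocols with messages of fixed length -/

section FixedLength

variable {α : Type*} [Fintype α]

/-- A family of bits indexed by a finite type, written as a list of length `Fintype.card α`. -/
noncomputable def bitList (g : α → Bool) : List Bool :=
  List.ofFn fun n : Fin (Fintype.card α) => g ((Fintype.equivFin α).symm n)

theorem length_bitList (g : α → Bool) : (bitList g).length = Fintype.card α :=
  List.length_ofFn

theorem bitList_injective : Function.Injective (bitList : (α → Bool) → List Bool) := by
  intro g g' h
  have h' := List.ofFn_injective h
  funext a
  simpa using congrFun h' (Fintype.equivFin α a)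

/-- The transcript of `i` rounds in which Alice sends `a 0, a 1, …` and Bob sends
`b 0, b 1, …`. -/
def interleave (a b : ℕ → List Bool) : ℕ → List (List Bool)
  | 0 => []
  | i + 1 => interleave a b i ++ [a i, b i]

theorem length_interleave (a b : ℕ → List Bool) (i : ℕ) :
    (interleave a b i).length = 2 * i := by
  induction i with
  | zero => rfl
  | succ i ih => simp [interleave, ih]; ring

theorem eq_of_interleave_eq {a b a' b' : ℕ → List Bool} {i : ℕ}
    (h : interleave a b i = interleave a' b' i) : ∀ j < i, a j = a' j ∧ b j = b' j := by
  induction i with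
  | zero => intro j hj; omega
  | succ i ih =>
    obtain ⟨h1, h2⟩ := List.append_inj h (by simp [length_interleave])
    intro j hj
    rcases Nat.lt_succ_iff_lt_or_eq.mp hj with hj | rfl
    · exact ih h1 j hj
    · simpa using h2

theorem sum_length_interleave (a b : ℕ → List Bool) (m : ℕ) :
    ((interleave a b m).map List.length).sum =
      ∑ i ∈ Finset.range m, ((a i).length + (b i).length) := by
  induction m with
  | zero => rfl
  | succ m ih => simp [interleave, ih, Finset.sum_range_succ]

open Classical in
/-- Prescribed messages `msgA`, `msgB` of fixed lengths, and a prescribed output, are those of a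
protocol as soon as each of them is determined by the sender's input and the messages received
before. The parties work by consistency: given a transcript, the sender picks any input of the other
party that explains it, and sends the message for that input. -/
theorem exists_protocol {b : ℕ} (m : ℕ) (len : ℕ → ℕ)
    (msgA msgB : Coins → Bits b → Bits b → ℕ → List Bool) (out : Coins → Bits b → Bits b → ℝ)
    (lenA : ∀ ω x y i, (msgA ω x y i).length = len i)
    (lenB : ∀ ω x y i, (msgB ω x y i).length = len i)
    (hA : ∀ ω x y y' i, i < m → (∀ j < i, msgB ω x y j = msgB ω x y' j) →
      msgA ω x y i = msgA ω x y' i)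
    (hB : ∀ ω x x' y i, i < m → (∀ j < i, msgA ω x y j = msgA ω x' y j) →
      msgB ω x y i = msgB ω x' y i)
    (hout : ∀ ω x x' y, (∀ j < m, msgA ω x y j = msgA ω x' y j) → out ω x y = out ω x' y) :
    ∃ P : Protocol b, P.rounds = m ∧ P.result = out ∧
      ∀ ω x y, P.bits ω x y = ∑ i ∈ Finset.range m, 2 * len i := by
  let tr (ω : Coins) (x y : Bits b) : ℕ → List (List Bool) :=
    interleave (msgA ω x y) (msgB ω x y)
  let alice (ω : Coins) (x : Bits b) (l : List (List Bool)) : List Bool :=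
    if h : ∃ y, l = tr ω x y (l.length / 2) then msgA ω x h.choose (l.length / 2)
    else List.replicate (len (l.length / 2)) false
  let bob (ω : Coins) (y : Bits b) (l : List (List Bool)) : List Bool :=
    if h : ∃ x, l = tr ω x y (l.length / 2) ++ [msgA ω x y (l.length / 2)] then
      msgB ω h.choose y (l.length / 2)
    else List.replicate (len (l.length / 2)) false
  have alice_len (ω : Coins) (x : Bits b) (l : List (List Bool)) :
      (alice ω x l).length = len (l.length / 2) := by
    simp only [alice]
    split
    · exact lenA _ _ _ _
    · exact List.length_replicate
  have bob_len (ω : Coins) (y : Bits b) (l : List (List Bool)) :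
      (bob ω y l).length = len (l.length / 2) := by
    simp only [bob]
    split
    · exact lenB _ _ _ _
    · exact List.length_replicate
  let P : Protocol b :=
    { rounds := m
      alice := alice
      bob := bob
      output := fun ω y l => if h : ∃ x, l = tr ω x y m then out ω h.choose y else 0
      alice_prefix := fun ω l x x' h => h.eq_of_length (by rw [alice_len, alice_len])
      bob_prefix := fun ω l y y' h => h.eq_of_length (by rw [bob_len, bob_len]) }
  have alice_eq (ω : Coins) (x y : Bits b) (i : ℕ) (hi : i < m) :
      alice ω x (tr ω x y i) = msgA ω x y i := by
    have hlen : (tr ω x y i).length / 2 = i := by simp [tr, length_interleave]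
    have hex : ∃ y', tr ω x y i = tr ω x y' i := ⟨y, rfl⟩
    simp only [alice, hlen, hex, dif_pos]
    exact (hA ω x y _ i hi fun j hj => (eq_of_interleave_eq hex.choose_spec j hj).2).symm
  have bob_eq (ω : Coins) (x y : Bits b) (i : ℕ) (hi : i < m) :
      bob ω y (tr ω x y i ++ [msgA ω x y i]) = msgB ω x y i := by
    have hlen : (tr ω x y i ++ [msgA ω x y i]).length / 2 = i := by
      simp [tr, length_interleave]; omega
    have hex : ∃ x', tr ω x y i ++ [msgA ω x y i] = tr ω x' y i ++ [msgA ω x' y i] := ⟨x, rfl⟩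
    simp only [bob, hlen, hex, dif_pos]
    have h1 := (List.append_inj hex.choose_spec (by simp [tr, length_interleave])).1
    exact (hB ω x _ y i hi fun j hj => (eq_of_interleave_eq h1 j hj).1).symm
  have transcript_eq (ω : Coins) (x y : Bits b) (i : ℕ) (hi : i ≤ m) :
      P.transcript ω x y i = tr ω x y i := by
    induction i with
    | zero => rfl
    | succ i ih =>
      simp only [Protocol.transcript, ih (Nat.le_of_succ_le hi)]
      change tr ω x y i ++ [alice ω x (tr ω x y i),
        bob ω y (tr ω x y i ++ [alice ω x (tr ω x y i)])] = _
      rw [alice_eq ω x y i hi, bob_eq ω x y i hi]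
      rfl
  refine ⟨P, rfl, ?_, fun ω x y => ?_⟩
  · funext ω x y
    have hex : ∃ x', tr ω x y m = tr ω x' y m := ⟨x, rfl⟩
    have : P.result ω x y = if h : ∃ x', tr ω x y m = tr ω x' y m then out ω h.choose y else 0 := by
      simp only [Protocol.result]
      rw [transcript_eq ω x y _ le_rfl]
    rw [this, dif_pos hex]
    exact (hout ω x _ y fun j hj => (eq_of_interleave_eq hex.choose_spec j hj).1).symm
  · rw [Protocol.bits, transcript_eq ω x y _ le_rfl]
    simp only [tr, sum_length_interleave, lenA, lenB, two_mul]

end FixedLength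

/-! ### Runs of a distributed algorithm seen from one side of a moving cut -/

section Cut

variable {G : Network} {b : ℕ}

/-- For a clock `c`, a party is to know the state of `v` at the times `τ < c v`. In round `τ` the
edge from `u` to `v` crosses the cut if the new state of `v` is to be known, while the state of `u`
is no longer known. -/
def Crosses (c : G.V → ℕ) (τ : ℕ) (u v : G.V) : Prop :=
  G.copies u v ≠ 0 ∧ c u ≤ τ ∧ τ + 1 < c v

/-- In every round each of the `k` lanes has at most one edge that crosses the cut, every crossing
edge lies in a lane, and crossing edges have a single copy. -/
structure IsLaneCut (c : G.V → ℕ) (lane : G.V → ℕ) (k : ℕ) : Prop where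
  copies_le_one : ∀ {τ u v}, Crosses c τ u v → G.copies u v ≤ 1
  lane_lt : ∀ {τ u v}, Crosses c τ u v → lane u < k
  unique : ∀ {τ u v u' v'}, Crosses c τ u v → Crosses c τ u' v' → lane u = lane u' →
    u = u' ∧ v = v'

open Classical in
/-- The bits of a message that are sent over the first copy of the edge. -/
noncomputable def firstCopy {u v : G.V} (μ : G.Msg u v) (l : Fin (Nat.log 2 G.size)) : Bool :=
  if h : ((0 : ℕ) : ℕ∞) < G.copies u v then μ ⟨0, h⟩ l else false

theorem eq_of_firstCopy_eq {u v : G.V} (h1 : G.copies u v ≤ 1) {μ μ' : G.Msg u v}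
    (h : firstCopy μ = firstCopy μ') : μ = μ' := by
  funext ⟨c, hc⟩ l
  have h0 : c = 0 := by
    have : (c : ℕ∞) < 1 := hc.trans_le h1
    exact_mod_cast Order.lt_one_iff.mp this
  subst h0
  have := congrFun h l
  simpa only [firstCopy, hc, dif_pos] using this

namespace DistAlgorithm

variable (A : DistAlgorithm G b)

/-- The message from `u` to `v` in round `τ`. -/
noncomputable def sent (ω : Coins) (x y : Bits b) (τ : ℕ) (u v : G.V) : G.Msg u v :=
  A.send u v (A.run ω x y τ u)

open Classical in
/-- The bits sent in round `τ` over the crossing edge of lane `z` (zeros if there is no such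
edge). -/
noncomputable def cutBits (c : G.V → ℕ) (lane : G.V → ℕ) (ω : Coins) (x y : Bits b) (τ z : ℕ)
    (l : Fin (Nat.log 2 G.size)) : Bool :=
  if h : ∃ p : G.V × G.V, Crosses c τ p.1 p.2 ∧ lane p.1 = z then
    firstCopy (A.sent ω x y τ h.choose.1 h.choose.2) l
  else false

variable {A} {c : G.V → ℕ} {lane : G.V → ℕ} {k : ℕ} {ω : Coins} {x y x' y' : Bits b}

theorem sent_eq_of_cutBits_eq (hc : IsLaneCut c lane k) {τ : ℕ}
    (h : ∀ z < k, A.cutBits c lane ω x y τ z = A.cutBits c lane ω x' y' τ z) {u v : G.V}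
    (huv : Crosses c τ u v) : A.sent ω x y τ u v = A.sent ω x' y' τ u v := by
  have hex : ∃ p : G.V × G.V, Crosses c τ p.1 p.2 ∧ lane p.1 = lane u := ⟨(u, v), huv, rfl⟩
  have hp : hex.choose = (u, v) :=
    Prod.ext_iff.mpr (hc.unique hex.choose_spec.1 huv hex.choose_spec.2)
  refine eq_of_firstCopy_eq (hc.copies_le_one huv) (funext fun l => ?_)
  have hl := congrFun (h (lane u) (hc.lane_lt huv)) l
  simp only [cutBits, dif_pos hex] at hl
  rwa [hp] at hl

theorem cutBits_eq_of_run_eq {τ : ℕ}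
    (h : ∀ u, c u ≤ τ → A.run ω x y τ u = A.run ω x' y' τ u) (z : ℕ) :
    A.cutBits c lane ω x y τ z = A.cutBits c lane ω x' y' τ z := by
  funext l
  simp only [cutBits]
  split
  · next hex => simp only [sent, h _ hex.choose_spec.1.2.1]
  · rfl

/-- Over an absent edge there is only one possible message. -/
theorem sent_eq_of_copies_eq_zero {τ : ℕ} {u v : G.V} (h : G.copies u v = 0) :
    A.sent ω x y τ u v = A.sent ω x' y' τ u v := by
  funext ⟨c, hc⟩
  exact absurd hc (by simp [h])

/-- Two runs that look the same initially to the party with clock `c`, and have the same bits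
crossing the cut, look the same as long as the clock allows. -/
theorem run_eq_of_cutBits_eq (hc : IsLaneCut c lane k) {T : ℕ}
    (h0 : ∀ v, 0 < c v → G.localInput x y v = G.localInput x' y' v)
    (h : ∀ τ < T, ∀ z < k, A.cutBits c lane ω x y τ z = A.cutBits c lane ω x' y' τ z) :
    ∀ v, T < c v → A.run ω x y T v = A.run ω x' y' T v := by
  induction T with
  | zero => intro v hv; simp only [run, h0 v hv]
  | succ T ih =>
    have ih := ih fun τ hτ => h τ (hτ.trans (Nat.lt_succ_self T))
    intro v hv
    have hs : ∀ u, A.sent ω x y T u v = A.sent ω x' y' T u v := by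
      intro u
      by_cases h1 : T < c u
      · simp only [sent, ih u h1]
      by_cases h2 : G.copies u v = 0
      · exact sent_eq_of_copies_eq_zero h2
      · exact sent_eq_of_cutBits_eq hc (h T (Nat.lt_succ_self T)) ⟨h2, not_lt.mp h1, hv⟩
    simp only [sent] at hs
    simp only [run, ih v (by omega), hs]

/-- Without any communication, what is known at time `T` determines the state of `v` for as many
further rounds as `v` has hops to the unknown nodes. -/
theorem run_add_eq_of_hops {g : G.V → ℕ} {T : ℕ}
    (hg : ∀ u v, G.copies u v ≠ 0 → g v ≤ g u + 1)
    (h : ∀ v, 0 < g v → A.run ω x y T v = A.run ω x' y' T v) (σ : ℕ) :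
    ∀ v, σ < g v → A.run ω x y (T + σ) v = A.run ω x' y' (T + σ) v := by
  induction σ with
  | zero => exact h
  | succ σ ih =>
    intro v hv
    have hs : ∀ u, A.sent ω x y (T + σ) u v = A.sent ω x' y' (T + σ) u v := by
      intro u
      by_cases h2 : G.copies u v = 0
      · exact sent_eq_of_copies_eq_zero h2
      · have := hg u v h2
        simp only [sent, ih u (by omega)]
    simp only [sent] at hs
    rw [← add_assoc]
    simp only [run, ih v (by omega), hs]

end DistAlgorithm

end Cut

/-! ### Lengths of the subpaths -/

section Lengths

variable {κ : ℝ} {Λ : ℕ}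

/-- `∑_{j ≤ j' ≤ N} φ'_{j'}`, the number of nodes on the subpaths `j, …, N` of one path. -/
noncomputable def tail (κ : ℝ) (Λ : ℕ) (j : ℕ) : ℕ :=
  ∑ j' ∈ Finset.Icc j (maxIndex κ Λ), phi' κ Λ (j' : ℤ)

theorem tail_eq_add {j : ℕ} (hj : j ≤ maxIndex κ Λ) :
    tail κ Λ j = phi' κ Λ (j : ℤ) + tail κ Λ (j + 1) := by
  rw [tail, tail, ← Finset.add_sum_Ioc_eq_sum_Icc hj, Finset.Icc_add_one_left_eq_Ioc]

theorem tail_succ_maxIndex : tail κ Λ (maxIndex κ Λ + 1) = 0 := by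
  simp [tail]

theorem tail_antitone : Antitone (tail κ Λ) := fun _ _ h =>
  Finset.sum_le_sum_of_subset (Finset.Icc_subset_Icc_left h)

theorem one_le_phi' (j : ℤ) : 1 ≤ phi' κ Λ j :=
  le_min (Nat.le_add_left _ _) (le_max_left _ _)

theorem phi'_le_phi (j : ℤ) : phi' κ Λ j ≤ phi κ Λ j := min_le_left _ _

theorem phi'_neg (j : ℤ) : phi' κ Λ (-j) = phi' κ Λ j := by
  simp only [phi', phi, Int.natAbs_neg]

theorem phi'_zero : phi' κ Λ 0 = 1 :=
  le_antisymm ((phi'_le_phi 0).trans (by simp [phi])) (one_le_phi' 0)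

/-- `⌈K Λ^κ⌉`, the number of nodes up to which the outer subpaths are built at full length. -/
noncomputable def budget (κ : ℝ) (Λ : ℕ) : ℕ := ⌈(⌈κ⌉₊ : ℝ) * (Λ : ℝ) ^ κ⌉₊

/-- The subpaths `j, …, N` are built at full length until the budget is exhausted. -/
theorem min_le_tail {j : ℕ} (hj : j ≤ maxIndex κ Λ + 1) :
    min (∑ j' ∈ Finset.Icc j (maxIndex κ Λ), phi κ Λ (j' : ℤ)) (budget κ Λ) ≤ tail κ Λ j := by
  induction hj using Nat.decreasingInduction with
  | self => simp
  | of_succ j hj ih =>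
    have hj : j ≤ maxIndex κ Λ := Nat.lt_succ_iff.mp hj
    rw [tail_eq_add hj, ← Finset.add_sum_Ioc_eq_sum_Icc hj]
    rw [Finset.Icc_add_one_left_eq_Ioc] at ih
    have h : phi' κ Λ (j : ℤ) = min (phi κ Λ j) (max 1 (budget κ Λ -
      ∑ j' ∈ Finset.Ioc j (maxIndex κ Λ), phi κ Λ (j' : ℤ))) := rfl
    omega

theorem maxIndex_eq (hκ : 1 ≤ κ) :
    maxIndex κ Λ = ⌈κ⌉₊ * Λ * Λ ^ (⌊κ⌋₊ - 1) := by
  have hk : 1 ≤ ⌊κ⌋₊ := Nat.one_le_floor_iff κ |>.mpr hκ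
  rw [maxIndex, mul_assoc, ← pow_succ', Nat.sub_add_cancel hk]

theorem one_le_maxIndex (hκ : 1 ≤ κ) (hΛ : 1 ≤ Λ) : 1 ≤ maxIndex κ Λ :=
  Nat.mul_pos (Nat.ceil_pos.mpr (by linarith)) (Nat.pow_pos hΛ)

/-- Comparison of `∑ φ_{j'}` with the arithmetic series `∑ j' / Λ^(k-1)`. -/
theorem le_sum_phi (hΛ : 1 ≤ Λ) {j : ℕ} (hj : j ≤ maxIndex κ Λ + 1) :
    (maxIndex κ Λ + 1 - j) * (maxIndex κ Λ + j) ≤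
      Λ ^ (⌊κ⌋₊ - 1) * (2 * ∑ j' ∈ Finset.Icc j (maxIndex κ Λ), phi κ Λ (j' : ℤ)) := by
  induction hj using Nat.decreasingInduction with
  | self => simp
  | of_succ j hj ih =>
    have hj : j ≤ maxIndex κ Λ := Nat.lt_succ_iff.mp hj
    rw [← Finset.add_sum_Ioc_eq_sum_Icc hj]
    rw [Finset.Icc_add_one_left_eq_Ioc] at ih
    have h : j ≤ Λ ^ (⌊κ⌋₊ - 1) * phi κ Λ (j : ℤ) := by
      rw [phi, Int.natAbs_natCast]
      exact (Nat.lt_mul_div_succ j (Nat.pow_pos hΛ)).le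
    obtain ⟨d, hd⟩ := Nat.exists_eq_add_of_le hj
    rw [hd] at ih ⊢
    have h1 : j + d + 1 - (j + 1) = d := by omega
    have h2 : j + d + 1 - j = d + 1 := by omega
    rw [h1] at ih
    rw [h2]
    nlinarith

/-- The average of `φ` over the subpaths `j, …, N` is at least `K Λ / 2`. -/
theorem mul_le_two_mul_sum_phi (hκ : 1 ≤ κ) (hΛ : 1 ≤ Λ) {j : ℕ} (hj : j ≤ maxIndex κ Λ + 1) :
    (maxIndex κ Λ + 1 - j) * (⌈κ⌉₊ * Λ) ≤
      2 * ∑ j' ∈ Finset.Icc j (maxIndex κ Λ), phi κ Λ (j' : ℤ) := by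
  refine Nat.le_of_mul_le_mul_left (le_trans ?_ (le_sum_phi hΛ hj))
    (Nat.pow_pos hΛ : 0 < Λ ^ (⌊κ⌋₊ - 1))
  calc Λ ^ (⌊κ⌋₊ - 1) * ((maxIndex κ Λ + 1 - j) * (⌈κ⌉₊ * Λ))
      = (maxIndex κ Λ + 1 - j) * maxIndex κ Λ := by
        nth_rw 3 [maxIndex_eq hκ]
        ring
    _ ≤ _ := Nat.mul_le_mul_left _ (Nat.le_add_right _ _)

theorem mul_le_budget (hκ : 1 ≤ κ) (hΛ : 1 ≤ Λ) : ⌈κ⌉₊ * Λ ≤ budget κ Λ := by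
  have hΛ' : (1 : ℝ) ≤ Λ := by exact_mod_cast hΛ
  have h : ((⌈κ⌉₊ * Λ : ℕ) : ℝ) ≤ (budget κ Λ : ℝ) := by
    refine le_trans ?_ (Nat.le_ceil _)
    push_cast
    exact mul_le_mul_of_nonneg_left (Real.self_le_rpow_of_one_le hΛ' hκ) (Nat.cast_nonneg _)
  exact_mod_cast h

/-- Half of a path is long enough to use up the budget. -/
theorem budget_le_sum_phi (hκ : 1 ≤ κ) (hΛ : 1 ≤ Λ) :
    budget κ Λ ≤ ∑ j' ∈ Finset.Icc 1 (maxIndex κ Λ), phi κ Λ (j' : ℤ) := by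
  set S := ∑ j' ∈ Finset.Icc 1 (maxIndex κ Λ), phi κ Λ (j' : ℤ) with hS
  have hΛ' : (1 : ℝ) ≤ Λ := by exact_mod_cast hΛ
  have hN : 1 ≤ maxIndex κ Λ := one_le_maxIndex hκ hΛ
  have hK : κ ≤ ⌈κ⌉₊ := Nat.le_ceil κ
  -- the sharp form of the arithmetic series, without rounding `N + 1` to `N`
  have h1 : ⌈κ⌉₊ * Λ * (maxIndex κ Λ + 1) ≤ 2 * S := by
    refine Nat.le_of_mul_le_mul_left (le_trans (le_of_eq ?_) (le_sum_phi hΛ (by omega)))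
      (Nat.pow_pos hΛ : 0 < Λ ^ (⌊κ⌋₊ - 1))
    rw [Nat.add_sub_cancel]
    nth_rw 2 [maxIndex_eq hκ]
    ring
  have h1' : (⌈κ⌉₊ : ℝ) * Λ * (⌈κ⌉₊ * Λ ^ ⌊κ⌋₊ + 1) ≤ 2 * S := by
    rw [maxIndex] at h1
    exact_mod_cast h1
  refine Nat.ceil_le.mpr ?_
  rcases (show 1 ≤ ⌈κ⌉₊ from Nat.ceil_pos.mpr (by linarith)).eq_or_lt with hK1 | hK2
  · have hκ1 : κ = 1 := le_antisymm (by rw [← hK1] at hK; exact_mod_cast hK) hκ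
    subst hκ1
    simp only [Nat.ceil_one, Nat.floor_one, Nat.cast_one, one_mul, pow_one, Real.rpow_one] at h1' ⊢
    nlinarith
  · have hκk : κ ≤ ((⌊κ⌋₊ + 1 : ℕ) : ℝ) := by
      push_cast
      exact (Nat.lt_floor_add_one κ).le
    have h2 : (Λ : ℝ) ^ κ ≤ Λ ^ (⌊κ⌋₊ + 1) := by
      rw [← Real.rpow_natCast]
      exact Real.rpow_le_rpow_of_exponent_le hΛ' hκk
    have h3 : (2 : ℝ) ≤ ⌈κ⌉₊ := by exact_mod_cast hK2
    have h4 : (0 : ℝ) ≤ Λ ^ (⌊κ⌋₊ + 1) := by positivity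
    have h5 : (⌈κ⌉₊ : ℝ) * (Λ : ℝ) ^ κ ≤ ⌈κ⌉₊ * Λ ^ (⌊κ⌋₊ + 1) :=
      mul_le_mul_of_nonneg_left h2 (Nat.cast_nonneg _)
    have h6 : 2 * ((⌈κ⌉₊ : ℝ) * Λ ^ (⌊κ⌋₊ + 1)) ≤ ⌈κ⌉₊ * (⌈κ⌉₊ * Λ ^ (⌊κ⌋₊ + 1)) :=
      mul_le_mul_of_nonneg_right h3 (by positivity)
    have h7 : (⌈κ⌉₊ : ℝ) * Λ * (⌈κ⌉₊ * Λ ^ ⌊κ⌋₊ + 1) =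
        ⌈κ⌉₊ * (⌈κ⌉₊ * Λ ^ (⌊κ⌋₊ + 1)) + ⌈κ⌉₊ * Λ := by ring
    have h8 : (0 : ℝ) ≤ ⌈κ⌉₊ * Λ := by positivity
    linarith

theorem budget_lt_tail_zero (hκ : 1 ≤ κ) (hΛ : 1 ≤ Λ) : budget κ Λ < tail κ Λ 0 := by
  have h1 := min_le_tail (κ := κ) (Λ := Λ) (j := 1) (by omega)
  rw [min_eq_right (budget_le_sum_phi hκ hΛ)] at h1
  have h2 := tail_eq_add (κ := κ) (Λ := Λ) (Nat.zero_le _)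
  have h3 := one_le_phi' (κ := κ) (Λ := Λ) ((0 : ℕ) : ℤ)
  rw [zero_add] at h2
  omega

/-- As long as the budget is not exceeded, the `m` outermost subpaths have at least `K Λ / 4` nodes
on average: the `m - 1` outermost ones have full length, and the last one can be neglected. -/
theorem mul_le_four_mul_tail (hκ : 1 ≤ κ) (hΛ : 1 ≤ Λ) {m : ℕ} (hm : m ≤ maxIndex κ Λ)
    (hB : tail κ Λ (maxIndex κ Λ + 1 - m) ≤ budget κ Λ) :
    m * (⌈κ⌉₊ * Λ) ≤ 4 * tail κ Λ (maxIndex κ Λ + 1 - m) := by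
  rcases m with _ | m
  · simp
  have e1 : maxIndex κ Λ + 1 - (m + 1) = maxIndex κ Λ - m := by omega
  rw [e1] at hB ⊢
  have e2 := tail_eq_add (κ := κ) (Λ := Λ) (j := maxIndex κ Λ - m) (Nat.sub_le _ _)
  have e3 := one_le_phi' (κ := κ) (Λ := Λ) ((maxIndex κ Λ - m : ℕ) : ℤ)
  have h1 := min_le_tail (κ := κ) (Λ := Λ) (j := maxIndex κ Λ - m) (by omega)
  have h2 := min_le_tail (κ := κ) (Λ := Λ) (j := maxIndex κ Λ - m + 1) (by omega)
  have h3 := mul_le_two_mul_sum_phi hκ hΛ (j := maxIndex κ Λ - m) (by omega)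
  have h4 := mul_le_two_mul_sum_phi hκ hΛ (j := maxIndex κ Λ - m + 1) (by omega)
  have e4 : maxIndex κ Λ + 1 - (maxIndex κ Λ - m) = m + 1 := by omega
  have e5 : maxIndex κ Λ + 1 - (maxIndex κ Λ - m + 1) = m := by omega
  rw [e4] at h3
  rw [e5] at h4
  have h5 := mul_le_budget hκ hΛ
  rw [Nat.add_mul, Nat.one_mul] at h3 ⊢
  rcases m.eq_zero_or_pos with rfl | hm0
  · simp only [Nat.zero_mul, Nat.zero_add] at *
    omega
  · have h6 : ⌈κ⌉₊ * Λ ≤ m * (⌈κ⌉₊ * Λ) := Nat.le_mul_of_pos_left _ hm0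
    generalize m * (⌈κ⌉₊ * Λ) = q at *
    omega

end Lengths

/-! ### The cut through the network -/

section Geometry

variable {Γ : ℕ} {κ : ℝ} {Λ : ℕ}

/-- Alice's clock: the number of rounds for which she can follow a node if she learns what is sent
over the highways. From `t` inwards it grows by one per node along the right halves of the paths;
a highway node has the clock of the path node below it. -/
noncomputable def clock (κ : ℝ) (Λ : ℕ) : Label → ℕ
  | .h _ a => tail κ Λ a.toNat
  | .v _ j m => if j < 0 then tail κ Λ 0 else tail κ Λ j.toNat - (m - 1)
  | .s => tail κ Λ 0
  | .t => 0

/-- The horizontal position of a node. -/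
noncomputable def pos (κ : ℝ) (Λ : ℕ) : Label → ℤ
  | .h _ a => a
  | .v _ j _ => j
  | .s => -(maxIndex κ Λ : ℤ)
  | .t => maxIndex κ Λ

/-- A lower bound for the number of edges from a node to the positions `≥ N - i`; no edge is longer
than `Λ^(k-1)`. -/
noncomputable def hops (κ : ℝ) (Λ : ℕ) (i : ℕ) (l : Label) : ℕ :=
  ((maxIndex κ Λ - i - pos κ Λ l).toNat + (Λ ^ (⌊κ⌋₊ - 1) - 1)) / Λ ^ (⌊κ⌋₊ - 1)

/-- Highway `x` is lane `x - 1`. -/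
def lane : Label → ℕ
  | .h x _ => x - 1
  | _ => 0

theorem clock_sub_le_of_otherEdge (hκ : 1 ≤ κ) (hΛ : 1 ≤ Λ) {u w : Label} (hu : IsNode Γ κ Λ u)
    (hw : IsNode Γ κ Λ w) (h : OtherEdge κ Λ u w) :
    clock κ Λ u ≤ clock κ Λ w + 1 ∧ clock κ Λ w ≤ clock κ Λ u + 1 := by
  have hN := one_le_maxIndex hκ hΛ
  cases h with
  | rung x a => simp [clock]
  | inner i j m =>
    simp only [clock]
    split <;> omega
  | outRight i j =>
    have hj : j ≤ maxIndex κ Λ := by simpa using hu.2.2.1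
    have h1 := tail_eq_add hj
    have h2 := one_le_phi' (κ := κ) (Λ := Λ) (j : ℤ)
    have e1 : ¬ (j : ℤ) < 0 := by omega
    have e2 : ¬ (j : ℤ) + 1 < 0 := by omega
    have e3 : ((j : ℤ) + 1).toNat = j + 1 := by omega
    simp only [clock, e1, e2, e3, if_false, Int.toNat_natCast]
    omega
  | outLeft i j =>
    have e2 : -((j : ℤ) + 1) < 0 := by omega
    rcases j.eq_zero_or_pos with rfl | hj
    · simp [clock, phi'_zero]
    · have e1 : -(j : ℤ) < 0 := by omega
      simp only [clock, e1, e2, if_true]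
      omega
  | leftEnds i i' => simp [clock, leftEnd]
  | rightEnds i i' => simp [clock, rightEnd]
  | ramp i j =>
    simp only [clock]
    split
    · next hj =>
      have : j.toNat = 0 := by omega
      simp [this]
    · simp
  | source i =>
    have e1 : -(maxIndex κ Λ : ℤ) < 0 := by omega
    simp only [clock, leftEnd, e1, if_true]
    omega
  | target i =>
    have h1 := tail_eq_add (le_refl (maxIndex κ Λ))
    rw [tail_succ_maxIndex] at h1
    have e1 : ¬ (maxIndex κ Λ : ℤ) < 0 := by omega
    simp only [clock, rightEnd, e1, if_false, Int.toNat_natCast]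
    omega

theorem abs_pos_sub_le_of_otherEdge (hΛ : 1 ≤ Λ) {u w : Label} (h : OtherEdge κ Λ u w) :
    |pos κ Λ u - pos κ Λ w| ≤ (Λ ^ (⌊κ⌋₊ - 1) : ℕ) := by
  have hD : 1 ≤ Λ ^ (⌊κ⌋₊ - 1) := Nat.pow_pos hΛ
  generalize Λ ^ (⌊κ⌋₊ - 1) = D at hD
  cases h <;> simp only [pos, leftEnd, rightEnd, abs_le] <;> omega

theorem abs_pos_sub_le_of_highwayEdge (hΛ : 1 ≤ Λ) {u w : Label} (hu : IsNode Γ κ Λ u)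
    (h : HighwayEdge κ Λ u w) : |pos κ Λ u - pos κ Λ w| ≤ (Λ ^ (⌊κ⌋₊ - 1) : ℕ) := by
  obtain ⟨x, a⟩ := h
  have hx : 1 ≤ x := hu.1
  have h1 : Λ ^ (⌊κ⌋₊ - x) ≤ Λ ^ (⌊κ⌋₊ - 1) := Nat.pow_le_pow_right hΛ (by omega)
  simp only [pos, sub_add_cancel_left, abs_neg, ← Nat.cast_pow, Nat.abs_cast]
  exact_mod_cast h1

theorem edge_of_copies_ne_zero {u w : (networkG Γ κ Λ).V}
    (h : (networkG Γ κ Λ).copies u w ≠ 0) :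
    (HighwayEdge κ Λ u.1 w.1 ∨ HighwayEdge κ Λ w.1 u.1) ∨
      OtherEdge κ Λ u.1 w.1 ∨ OtherEdge κ Λ w.1 u.1 := by
  by_contra hn
  rw [not_or] at hn
  exact h (by simp only [networkG, if_neg hn.1, if_neg hn.2])

theorem hops_le_hops_add_one (hΛ : 1 ≤ Λ) (i : ℕ) (u w : (networkG Γ κ Λ).V)
    (h : (networkG Γ κ Λ).copies u w ≠ 0) :
    hops κ Λ i w.1 ≤ hops κ Λ i u.1 + 1 := by
  have hpos : |pos κ Λ u.1 - pos κ Λ w.1| ≤ (Λ ^ (⌊κ⌋₊ - 1) : ℕ) := by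
    rcases edge_of_copies_ne_zero h with (h | h) | h | h
    · exact abs_pos_sub_le_of_highwayEdge hΛ u.2 h
    · rw [abs_sub_comm]
      exact abs_pos_sub_le_of_highwayEdge hΛ w.2 h
    · exact abs_pos_sub_le_of_otherEdge hΛ h
    · rw [abs_sub_comm]
      exact abs_pos_sub_le_of_otherEdge hΛ h
  have hD : 0 < Λ ^ (⌊κ⌋₊ - 1) := Nat.pow_pos hΛ
  rw [hops, hops]
  generalize Λ ^ (⌊κ⌋₊ - 1) = D at *
  rw [← Nat.add_div_right _ hD]
  rw [abs_le] at hpos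
  exact Nat.div_le_div_right (by omega)

/-- Alice still knows the nodes at positions `< N - i` at the time `∑_{j > N - i} φ'_j`. -/
theorem tail_lt_clock_of_hops_pos (hΛ : 1 ≤ Λ) {i : ℕ} (hi : i ≤ maxIndex κ Λ) {l : Label}
    (hl : IsNode Γ κ Λ l) (h : 0 < hops κ Λ i l) :
    tail κ Λ (maxIndex κ Λ + 1 - i) < clock κ Λ l := by
  have hD : 0 < Λ ^ (⌊κ⌋₊ - 1) := Nat.pow_pos hΛ
  have hpos : pos κ Λ l < maxIndex κ Λ - i := by
    by_contra hn
    have h0 : (maxIndex κ Λ - i - pos κ Λ l).toNat = 0 := by omega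
    rw [hops, h0, zero_add, Nat.div_eq_of_lt (by omega)] at h
    exact h.false
  have e1 : maxIndex κ Λ + 1 - i = maxIndex κ Λ - i + 1 := by omega
  have h1 := tail_eq_add (κ := κ) (Λ := Λ) (j := maxIndex κ Λ - i) (Nat.sub_le _ _)
  have h2 := one_le_phi' (κ := κ) (Λ := Λ) ((maxIndex κ Λ - i : ℕ) : ℤ)
  have h0 := tail_antitone (κ := κ) (Λ := Λ) (Nat.zero_le (maxIndex κ Λ - i))
  rw [e1]
  cases l with
  | h x a =>
    simp only [pos, clock] at hpos ⊢
    have := tail_antitone (κ := κ) (Λ := Λ) (show a.toNat ≤ maxIndex κ Λ - i by omega)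
    omega
  | v p j m =>
    simp only [pos, clock] at hpos ⊢
    split
    · omega
    · next hj =>
      obtain ⟨j, rfl⟩ := Int.eq_ofNat_of_zero_le (not_lt.mp hj)
      have h3 := tail_antitone (κ := κ) (Λ := Λ) (show j + 1 ≤ maxIndex κ Λ - i by omega)
      have h4 := tail_eq_add (κ := κ) (Λ := Λ) (show j ≤ maxIndex κ Λ by omega)
      have h5 : m ≤ phi' κ Λ (j : ℤ) := hl.2.2.2.2
      simp only [Int.toNat_natCast]
      omega
  | s => simp only [clock]; omega
  | t => simp only [pos] at hpos; omega

/-- The subpath `N - i` is short enough for its length to be a lower bound on the number of hops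
from the left half of the network to the position `N - i`. -/
theorem phi'_le_hops (hΛ : 1 ≤ Λ) {i : ℕ} (hi : i ≤ maxIndex κ Λ) {l : Label}
    (hl : pos κ Λ l < 0) : phi' κ Λ ((maxIndex κ Λ - i : ℕ) : ℤ) ≤ hops κ Λ i l := by
  have hD : 0 < Λ ^ (⌊κ⌋₊ - 1) := Nat.pow_pos hΛ
  refine (phi'_le_phi _).trans ?_
  rw [phi, Int.natAbs_natCast, hops]
  generalize Λ ^ (⌊κ⌋₊ - 1) = D at *
  rw [← Nat.add_div_right _ hD]
  exact Nat.div_le_div_right (by omega)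

theorem pos_pos_of_clock_lt (hκ : 1 ≤ κ) (hΛ : 1 ≤ Λ) {l : Label} (hl : IsNode Γ κ Λ l)
    (h : clock κ Λ l < tail κ Λ 0) : 0 < pos κ Λ l := by
  have hN := one_le_maxIndex hκ hΛ
  cases l with
  | h x a =>
    simp only [clock, pos] at h ⊢
    by_contra hn
    rw [Int.toNat_eq_zero.mpr (not_lt.mp hn)] at h
    exact h.false
  | v p j m =>
    simp only [clock, pos] at h ⊢
    split at h
    · omega
    · next hj =>
      by_contra hn
      obtain rfl : j = 0 := by omega
      have h5 : m ≤ phi' κ Λ 0 := hl.2.2.2.2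
      rw [phi'_zero] at h5
      simp only [Int.toNat_zero] at h
      omega
  | s => simp only [clock] at h; omega
  | t => simp only [pos]; omega

/-- An edge that crosses Alice's cut joins consecutive nodes of a highway. -/
theorem exists_of_crosses (hκ : 1 ≤ κ) (hΛ : 1 ≤ Λ) {τ : ℕ} {u w : (networkG Γ κ Λ).V}
    (h : Crosses (fun v : (networkG Γ κ Λ).V => clock κ Λ v.1) τ u w) :
    ∃ x a, u.1 = .h x (a + (Λ : ℤ) ^ (⌊κ⌋₊ - x)) ∧ w.1 = .h x a := by
  obtain ⟨h0, h1, h2⟩ := h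
  simp only at h1 h2
  rcases edge_of_copies_ne_zero h0 with (h | h) | h | h
  · -- a highway edge in this direction would decrease the clock
    exfalso
    obtain ⟨u, hu⟩ := u
    obtain ⟨w, hw⟩ := w
    obtain ⟨x, a⟩ := h
    simp only [clock] at h1 h2
    have h3 : (0 : ℤ) ≤ (Λ : ℤ) ^ (⌊κ⌋₊ - x) := by positivity
    have := tail_antitone (κ := κ) (Λ := Λ)
      (show a.toNat ≤ (a + (Λ : ℤ) ^ (⌊κ⌋₊ - x)).toNat by omega)
    omega
  · obtain ⟨u, hu⟩ := u
    obtain ⟨w, hw⟩ := w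
    obtain ⟨x, a⟩ := h
    exact ⟨x, a, rfl, rfl⟩
  · have := (clock_sub_le_of_otherEdge hκ hΛ u.2 w.2 h).2
    omega
  · have := (clock_sub_le_of_otherEdge hκ hΛ w.2 u.2 h).1
    omega

theorem isLaneCut_clock (hκ : 1 ≤ κ) (hΛ : 1 ≤ Λ) :
    IsLaneCut (fun v : (networkG Γ κ Λ).V => clock κ Λ v.1) (fun v => lane v.1) ⌊κ⌋₊ where
  copies_le_one {τ u w} h := by
    obtain ⟨x, a, hu, hw⟩ := exists_of_crosses hκ hΛ h
    have : HighwayEdge κ Λ w.1 u.1 := by rw [hu, hw]; exact ⟨x, a⟩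
    simp only [networkG, this, or_true, if_true, le_refl]
  lane_lt {τ u w} h := by
    obtain ⟨x, a, hu, hw⟩ := exists_of_crosses hκ hΛ h
    have hx := u.2
    simp only [hu, lane, IsNode] at hx ⊢
    omega
  unique {τ u w u' w'} h h' hl := by
    obtain ⟨x, a, hu, hw⟩ := exists_of_crosses hκ hΛ h
    obtain ⟨x', a', hu', hw'⟩ := exists_of_crosses hκ hΛ h'
    obtain ⟨-, h1, h2⟩ := h
    obtain ⟨-, h1', h2'⟩ := h'
    obtain ⟨u, _⟩ := u
    obtain ⟨w, hn⟩ := w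
    obtain ⟨u', _⟩ := u'
    obtain ⟨w', hn'⟩ := w'
    simp only at hu hw hu' hw'
    subst hu hw hu' hw'
    simp only [clock, lane] at h1 h2 h1' h2' hl
    have hx : 1 ≤ x := hn.1
    have hx' : 1 ≤ x' := hn'.1
    obtain rfl : x = x' := by omega
    have hδ : (0 : ℤ) < (Λ : ℤ) ^ (⌊κ⌋₊ - x) := by positivity
    -- two crossing edges of one highway cannot lie beside each other, since the clock is monotone
    have key : ∀ c d : ℤ, (Λ : ℤ) ^ (⌊κ⌋₊ - x) ∣ c → (Λ : ℤ) ^ (⌊κ⌋₊ - x) ∣ d →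
        tail κ Λ (c + (Λ : ℤ) ^ (⌊κ⌋₊ - x)).toNat ≤ τ → τ + 1 < tail κ Λ d.toNat → d ≤ c := by
      intro c d hc hd h3 h4
      by_contra! hlt
      have h5 := Int.le_of_dvd (sub_pos.mpr hlt) (dvd_sub hd hc)
      have := tail_antitone (κ := κ) (Λ := Λ)
        (show (c + (Λ : ℤ) ^ (⌊κ⌋₊ - x)).toNat ≤ d.toNat by omega)
      omega
    obtain rfl : a = a' :=
      le_antisymm (key a' a hn'.2.2.1 hn.2.2.1 h1' h2) (key a a' hn.2.2.1 hn'.2.2.1 h1 h2')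
    exact ⟨rfl, rfl⟩

end Geometry

/-! ### From a pair of cuts to a direct protocol -/

section Simulation

variable {G : Network} {b : ℕ}

theorem IsLaneCut.comp {c lane : G.V → ℕ} {k : ℕ} (hc : IsLaneCut c lane k) {e : G.V → G.V}
    (he : Function.Injective e) (hcopies : ∀ u v, G.copies (e u) (e v) = G.copies u v) :
    IsLaneCut (c ∘ e) (lane ∘ e) k := by
  have h : ∀ {τ u v}, Crosses (c ∘ e) τ u v → Crosses c τ (e u) (e v) := fun ⟨h0, h1⟩ =>
    ⟨by rwa [hcopies], h1⟩
  refine ⟨fun h1 => ?_, fun h1 => hc.lane_lt (h h1), fun h1 h2 hl => ?_⟩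
  · rw [← hcopies]
    exact hc.copies_le_one (h h1)
  · exact (hc.unique (h h1) (h h2) hl).imp (fun h => he h) (fun h => he h)

theorem exists_mem_block {T q : ℕ → ℕ} (hT0 : T 0 = 0) {i : ℕ}
    (hT : ∀ j < i, T (j + 1) = T j + q j) {τ : ℕ} (hτ : τ < T i) :
    ∃ j < i, ∃ σ < q j, τ = T j + σ := by
  induction i with
  | zero => omega
  | succ i ih =>
    by_cases h : τ < T i
    · obtain ⟨j, hj, h⟩ := ih (fun j hj => hT j (by omega)) h
      exact ⟨j, by omega, h⟩
    · have := hT i (Nat.lt_succ_self i)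
      exact ⟨i, Nat.lt_succ_self i, τ - T i, by omega, by omega⟩

namespace DistAlgorithm

/-- All bits that cross the cut in the `q` rounds after time `t`, as one message. -/
noncomputable def blockMsg (A : DistAlgorithm G b) (c lane : G.V → ℕ) (k : ℕ) (ω : Coins)
    (x y : Bits b) (t q : ℕ) : List Bool :=
  bitList fun p : Fin q × Fin k × Fin (Nat.log 2 G.size) =>
    A.cutBits c lane ω x y (t + p.1) p.2.1 p.2.2

variable {A : DistAlgorithm G b} {c c' lane : G.V → ℕ} {g : ℕ → G.V → ℕ} {k : ℕ} {ω : Coins}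
  {x y x' y' : Bits b} {T q : ℕ → ℕ} {i : ℕ}

theorem length_blockMsg (t n : ℕ) :
    (A.blockMsg c lane k ω x y t n).length = n * (k * Nat.log 2 G.size) := by
  simp [blockMsg, length_bitList]

theorem blockMsg_eq_iff {t n : ℕ} :
    A.blockMsg c lane k ω x y t n = A.blockMsg c lane k ω x' y' t n ↔ ∀ σ < n, ∀ z < k,
      A.cutBits c lane ω x y (t + σ) z = A.cutBits c lane ω x' y' (t + σ) z := by
  refine bitList_injective.eq_iff.trans ⟨fun h σ hσ z hz => funext fun l => ?_, fun h => ?_⟩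
  · exact congrFun h (⟨σ, hσ⟩, ⟨z, hz⟩, l)
  · funext p
    exact congrFun (h p.1 p.1.2 p.2.1 p.2.1.2) p.2.2

/-- What one party has received in the blocks before time `T i` determines what it can follow
without further communication. -/
theorem run_eq_of_blockMsg_eq (hc : IsLaneCut c lane k) (hT0 : T 0 = 0)
    (hT : ∀ j < i, T (j + 1) = T j + q j)
    (hg : ∀ u v, G.copies u v ≠ 0 → g i v ≤ g i u + 1) (hgc : ∀ v, 0 < g i v → T i < c v)
    (h0 : ∀ v, 0 < c v → G.localInput x y v = G.localInput x' y' v)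
    (h : ∀ j < i, A.blockMsg c lane k ω x y (T j) (q j) = A.blockMsg c lane k ω x' y' (T j) (q j))
    {σ : ℕ} {v : G.V} (hσ : σ < g i v) :
    A.run ω x y (T i + σ) v = A.run ω x' y' (T i + σ) v := by
  refine run_add_eq_of_hops hg (fun v hv => ?_) σ v hσ
  refine run_eq_of_cutBits_eq hc h0 (fun τ hτ => ?_) v (hgc v hv)
  obtain ⟨j, hj, σ, hσ, rfl⟩ := exists_mem_block hT0 hT hτ
  exact blockMsg_eq_iff.mp (h j hj) σ hσ

/-- If the nodes that the other party (clock `c'`) loses from sight stay followable for a block,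
then the message of this party for that block is determined by what it has received before. -/
theorem blockMsg_eq_of_blockMsg_eq (hc : IsLaneCut c lane k) (hT0 : T 0 = 0)
    (hT : ∀ j < i + 1, T (j + 1) = T j + q j)
    (hg : ∀ u v, G.copies u v ≠ 0 → g i v ≤ g i u + 1) (hgc : ∀ v, 0 < g i v → T i < c v)
    (hgq : ∀ v, c' v < T (i + 1) → q i ≤ g i v)
    (h0 : ∀ v, 0 < c v → G.localInput x y v = G.localInput x' y' v)
    (h : ∀ j < i,
      A.blockMsg c lane k ω x y (T j) (q j) = A.blockMsg c lane k ω x' y' (T j) (q j)) :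
    A.blockMsg c' lane k ω x y (T i) (q i) = A.blockMsg c' lane k ω x' y' (T i) (q i) := by
  refine blockMsg_eq_iff.mpr fun σ hσ z _ => cutBits_eq_of_run_eq (fun u hu => ?_) z
  have := hT i (Nat.lt_succ_self i)
  have := hgq u (by omega)
  exact run_eq_of_blockMsg_eq hc hT0 (fun j hj => hT j (by omega)) hg hgc h0 h (by omega)

/-- Simulation of `r` rounds of a distributed algorithm in `m` communication rounds. In the `i`-th
one, the parties tell each other all that crosses their cuts between the times `T i` and `T (i + 1)`;
after the time `T m` Bob needs no further help to follow `t`. -/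
theorem exists_protocol_of_cuts (A : DistAlgorithm G b) {cA cB : G.V → ℕ} {gA gB : ℕ → G.V → ℕ}
    {m r : ℕ} (hA : IsLaneCut cA lane k) (hB : IsLaneCut cB lane k)
    (hAt : cA G.t = 0) (hBs : cB G.s = 0)
    (hT0 : T 0 = 0) (hT : ∀ i < m, T (i + 1) = T i + q i)
    (hgA : ∀ i u v, G.copies u v ≠ 0 → gA i v ≤ gA i u + 1)
    (hgB : ∀ i u v, G.copies u v ≠ 0 → gB i v ≤ gB i u + 1)
    (hgcA : ∀ i ≤ m, ∀ v, 0 < gA i v → T i < cA v) (hgcB : ∀ i ≤ m, ∀ v, 0 < gB i v → T i < cB v)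
    (hgqA : ∀ i < m, ∀ v, cB v < T (i + 1) → q i ≤ gA i v)
    (hgqB : ∀ i < m, ∀ v, cA v < T (i + 1) → q i ≤ gB i v)
    (hr : T m ≤ r) (hrt : r - T m < gB m G.t) :
    ∃ P : Protocol b, P.rounds = m ∧ P.result = A.result r ∧
      ∀ ω x y, P.bits ω x y = 2 * (k * Nat.log 2 G.size) * T m := by
  have hinA (x y y' : Bits b) (v : G.V) (hv : 0 < cA v) :
      G.localInput x y v = G.localInput x y' v := by
    have hvt : v ≠ G.t := by rintro rfl; omega
    simp [Network.localInput, hvt]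
  have hinB (x x' y : Bits b) (v : G.V) (hv : 0 < cB v) :
      G.localInput x y v = G.localInput x' y v := by
    have hvs : v ≠ G.s := by rintro rfl; omega
    simp [Network.localInput, hvs]
  obtain ⟨P, h1, h2, h3⟩ := exists_protocol m (fun i => q i * (k * Nat.log 2 G.size))
    (fun ω x y i => A.blockMsg cB lane k ω x y (T i) (q i))
    (fun ω x y i => A.blockMsg cA lane k ω x y (T i) (q i)) (A.result r)
    (fun _ _ _ _ => length_blockMsg _ _) (fun _ _ _ _ => length_blockMsg _ _)
    (fun ω x y y' i hi => blockMsg_eq_of_blockMsg_eq hA hT0 (fun j hj => hT j (by omega)) (hgA i)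
      (hgcA i hi.le) (hgqA i hi) (hinA x y y'))
    (fun ω x x' y i hi => blockMsg_eq_of_blockMsg_eq hB hT0 (fun j hj => hT j (by omega)) (hgB i)
      (hgcB i hi.le) (hgqB i hi) (hinB x x' y))
    (fun ω x x' y h => by
      have := run_eq_of_blockMsg_eq hB hT0 hT (hgB m) (hgcB m le_rfl) (hinB x x' y) h hrt
      rw [Nat.add_sub_cancel' hr] at this
      simp only [result, this])
  refine ⟨P, h1, h2, fun ω x y => (h3 ω x y).trans ?_⟩
  clear h1 h2 h3 hr hrt hgcA hgcB hgqA hgqB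
  induction m with
  | zero => simp [hT0]
  | succ m ih =>
    rw [Finset.sum_range_succ, ih (fun i hi => hT i (by omega)), hT m (Nat.lt_succ_self m)]
    ring

end DistAlgorithm
end Simulation

/-! ### The mirror image of the network -/

section Mirror

variable {Γ : ℕ} {κ : ℝ} {Λ : ℕ}

/-- Reflection of the node names, which exchanges left and right. -/
def mirror : Label → Label
  | .h x a => .h x (-a)
  | .v i j m => .v i (-j) m
  | .s => .t
  | .t => .s

theorem mirror_mirror (l : Label) : mirror (mirror l) = l := by
  cases l <;> simp [mirror]

theorem lane_mirror (l : Label) : lane (mirror l) = lane l := by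
  cases l <;> rfl

theorem pos_mirror (l : Label) : pos κ Λ (mirror l) = -pos κ Λ l := by
  cases l <;> simp [mirror, pos]

theorem IsNode.mirror {l : Label} (h : IsNode Γ κ Λ l) : IsNode Γ κ Λ (mirror l) := by
  cases l with
  | h x a => simpa [BoundedRound.mirror, IsNode] using h
  | v i j m => simpa [BoundedRound.mirror, IsNode, phi'_neg] using h
  | s => trivial
  | t => trivial

theorem HighwayEdge.mirror {u w : Label} (h : HighwayEdge κ Λ u w) :
    HighwayEdge κ Λ (mirror w) (mirror u) := by
  obtain ⟨x, a⟩ := h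
  have := HighwayEdge.mk (κ := κ) (Λ := Λ) x (-(a + (Λ : ℤ) ^ (⌊κ⌋₊ - x)))
  simpa [BoundedRound.mirror] using this

theorem OtherEdge.mirror {u w : Label} (h : OtherEdge κ Λ u w) :
    OtherEdge κ Λ (mirror u) (mirror w) := by
  cases h with
  | rung x a => exact .rung x (-a)
  | inner i j m => exact .inner i (-j) m
  | outRight i j =>
    have := OtherEdge.outLeft (κ := κ) (Λ := Λ) i j
    rwa [phi'_neg] at this
  | outLeft i j =>
    have := OtherEdge.outRight (κ := κ) (Λ := Λ) i j
    simp only [BoundedRound.mirror, phi'_neg, neg_neg]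
    exact this
  | leftEnds i i' hne =>
    have := OtherEdge.rightEnds (κ := κ) (Λ := Λ) i i' hne
    simp only [BoundedRound.mirror, leftEnd, phi'_neg, neg_neg]
    exact this
  | rightEnds i i' hne =>
    have := OtherEdge.leftEnds (κ := κ) (Λ := Λ) i i' hne
    simp only [leftEnd, phi'_neg] at this
    exact this
  | ramp i j => exact .ramp i (-j)
  | source i =>
    have := OtherEdge.target (κ := κ) (Λ := Λ) i
    simp only [BoundedRound.mirror, leftEnd, phi'_neg, neg_neg]
    exact this
  | target i =>
    have := OtherEdge.source (κ := κ) (Λ := Λ) i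
    simp only [leftEnd, phi'_neg] at this
    exact this

theorem highwayEdge_mirror_iff {u w : Label} :
    HighwayEdge κ Λ (mirror u) (mirror w) ↔ HighwayEdge κ Λ w u :=
  ⟨fun h => by simpa only [mirror_mirror] using h.mirror, fun h => h.mirror⟩

theorem otherEdge_mirror_iff {u w : Label} :
    OtherEdge κ Λ (mirror u) (mirror w) ↔ OtherEdge κ Λ u w :=
  ⟨fun h => by simpa only [mirror_mirror] using h.mirror, fun h => h.mirror⟩

/-- Reflection of the network. -/
def mirrorNode (v : (networkG Γ κ Λ).V) : (networkG Γ κ Λ).V := ⟨mirror v.1, v.2.mirror⟩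

theorem mirrorNode_injective : Function.Injective (mirrorNode (Γ := Γ) (κ := κ) (Λ := Λ)) := by
  intro u v h
  have := congrArg mirror (congrArg Subtype.val h)
  simp only [mirrorNode, mirror_mirror] at this
  exact Subtype.ext this

theorem copies_mirrorNode (u v : (networkG Γ κ Λ).V) :
    (networkG Γ κ Λ).copies (mirrorNode u) (mirrorNode v) = (networkG Γ κ Λ).copies u v := by
  have h : (HighwayEdge κ Λ (mirror u.1) (mirror v.1) ∨ HighwayEdge κ Λ (mirror v.1) (mirror u.1)) ↔
      (HighwayEdge κ Λ u.1 v.1 ∨ HighwayEdge κ Λ v.1 u.1) := by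
    rw [highwayEdge_mirror_iff, highwayEdge_mirror_iff, or_comm]
  have h' : (OtherEdge κ Λ (mirror u.1) (mirror v.1) ∨ OtherEdge κ Λ (mirror v.1) (mirror u.1)) ↔
      (OtherEdge κ Λ u.1 v.1 ∨ OtherEdge κ Λ v.1 u.1) := by
    rw [otherEdge_mirror_iff, otherEdge_mirror_iff]
  classical
  exact if_congr h rfl (if_congr h' rfl rfl)

end Mirror

/-! ### The simulation on the network -/

section Main

variable {Γ : ℕ} {κ : ℝ} {Λ : ℕ}

/-- If `r` lies between `∑_{j > N - m} φ'_j` and `∑_{j ≥ N - m} φ'_j`, then `r` rounds on the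
network can be simulated with `m` rounds of direct communication. -/
theorem exists_protocol_of_tail (hκ : 1 ≤ κ) (hΛ : 1 ≤ Λ) {b : ℕ}
    (A : DistAlgorithm (networkG Γ κ Λ) b) {m r : ℕ} (hm : m ≤ maxIndex κ Λ)
    (h1 : tail κ Λ (maxIndex κ Λ + 1 - m) ≤ r) (h2 : r < tail κ Λ (maxIndex κ Λ - m)) :
    ∃ P : Protocol b, P.rounds = m ∧ P.result = A.result r ∧ ∀ ω x y, P.bits ω x y =
      2 * (⌊κ⌋₊ * Nat.log 2 (networkG Γ κ Λ).size) * tail κ Λ (maxIndex κ Λ + 1 - m) := by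
  have hcut := isLaneCut_clock (Γ := Γ) hκ hΛ
  have hcut' := hcut.comp mirrorNode_injective copies_mirrorNode
  have hlane : (fun v : (networkG Γ κ Λ).V => lane v.1) ∘ mirrorNode = fun v => lane v.1 :=
    funext fun v => lane_mirror v.1
  rw [hlane] at hcut'
  have hstep : ∀ i ≤ maxIndex κ Λ, tail κ Λ (maxIndex κ Λ - i) =
      tail κ Λ (maxIndex κ Λ + 1 - i) + phi' κ Λ ((maxIndex κ Λ - i : ℕ) : ℤ) := by
    intro i hi
    rw [tail_eq_add (Nat.sub_le _ _), add_comm, Nat.sub_add_comm hi]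
  have hle0 (i : ℕ) : tail κ Λ i ≤ tail κ Λ 0 := tail_antitone (Nat.zero_le i)
  have hN := one_le_maxIndex hκ hΛ
  refine A.exists_protocol_of_cuts hcut hcut'
    (T := fun i => tail κ Λ (maxIndex κ Λ + 1 - i))
    (q := fun i => phi' κ Λ ((maxIndex κ Λ - i : ℕ) : ℤ))
    (gA := fun i v => hops κ Λ i v.1) (gB := fun i v => hops κ Λ i (mirrorNode v).1)
    rfl rfl tail_succ_maxIndex (fun i hi => ?_) (hops_le_hops_add_one hΛ)
    (fun i u v huv => hops_le_hops_add_one hΛ i _ _ (by rwa [copies_mirrorNode]))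
    (fun i hi v hv => tail_lt_clock_of_hops_pos hΛ (hi.trans hm) v.2 hv)
    (fun i hi v hv => tail_lt_clock_of_hops_pos hΛ (hi.trans hm) (mirrorNode v).2 hv)
    (fun i hi v hv => ?_) (fun i hi v hv => ?_) h1 ?_
  · rw [← hstep i (by omega), Nat.add_sub_add_right]
  · -- a node that Bob loses from sight lies in the left half
    have := pos_pos_of_clock_lt hκ hΛ (mirrorNode v).2 (hv.trans_le (hle0 _))
    rw [mirrorNode, pos_mirror] at this
    exact phi'_le_hops hΛ (by omega) (by omega)
  · have := pos_pos_of_clock_lt hκ hΛ v.2 (hv.trans_le (hle0 _))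
    refine phi'_le_hops hΛ (by omega) ?_
    rw [mirrorNode, pos_mirror]
    omega
  · refine lt_of_lt_of_le ?_ (phi'_le_hops hΛ hm ?_)
    · have := hstep m hm
      omega
    · change -(maxIndex κ Λ : ℤ) < 0
      omega

/-- The simulation, with an integral bound on the number of bits. -/
theorem exists_protocol_of_algorithm (hκ : 1 ≤ κ) (hΛ : 1 ≤ Λ) {b : ℕ}
    (A : DistAlgorithm (networkG Γ κ Λ) b) {r : ℕ} (hr : (r : ℝ) ≤ κ * (Λ : ℝ) ^ κ) :
    ∃ P : Protocol b, P.result = A.result r ∧ (P.rounds : ℝ) ≤ 8 * (r : ℝ) / (κ * (Λ : ℝ)) ∧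
      ∀ ω x y, P.bits ω x y ≤ 2 * (⌊κ⌋₊ * Nat.log 2 (networkG Γ κ Λ).size) * r := by
  have hΛ' : (0 : ℝ) < Λ := by exact_mod_cast hΛ
  have hrB : r ≤ budget κ Λ := by
    have : (r : ℝ) ≤ budget κ Λ := (hr.trans (mul_le_mul_of_nonneg_right (Nat.le_ceil κ)
      (by positivity))).trans (Nat.le_ceil _)
    exact_mod_cast this
  have hex : ∃ m, r < tail κ Λ (maxIndex κ Λ - m) :=
    ⟨maxIndex κ Λ, by rw [Nat.sub_self]; exact hrB.trans_lt (budget_lt_tail_zero hκ hΛ)⟩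
  classical
  obtain ⟨m, h2, hmin⟩ : ∃ m, r < tail κ Λ (maxIndex κ Λ - m) ∧
      ∀ n < m, ¬ r < tail κ Λ (maxIndex κ Λ - n) :=
    ⟨Nat.find hex, Nat.find_spec hex, fun n hn => Nat.find_min hex hn⟩
  have hm : m ≤ maxIndex κ Λ := by
    by_contra! hlt
    refine hmin _ hlt ?_
    rwa [Nat.sub_self, ← Nat.sub_eq_zero_of_le hlt.le]
  have h1 : tail κ Λ (maxIndex κ Λ + 1 - m) ≤ r := by
    rcases m with _ | m
    · rw [Nat.sub_zero, tail_succ_maxIndex]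
      exact Nat.zero_le r
    · rw [Nat.add_sub_add_right]
      exact not_lt.mp (hmin m (Nat.lt_succ_self m))
  obtain ⟨P, hP1, hP2, hP3⟩ := exists_protocol_of_tail hκ hΛ A hm h1 h2
  refine ⟨P, hP2, ?_, fun ω x y => (hP3 ω x y).trans_le (Nat.mul_le_mul_left _ h1)⟩
  rw [hP1, le_div_iff₀ (by positivity)]
  have h3 : m * (⌈κ⌉₊ * Λ) ≤ 4 * r :=
    (mul_le_four_mul_tail hκ hΛ hm (h1.trans hrB)).trans (Nat.mul_le_mul_left _ h1)
  calc (m : ℝ) * (κ * Λ) ≤ m * (⌈κ⌉₊ * Λ) := by gcongr; exact Nat.le_ceil κ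
    _ ≤ 4 * r := by exact_mod_cast h3
    _ ≤ 8 * r := by linarith [(Nat.cast_nonneg r : (0 : ℝ) ≤ r)]

theorem distComplexity_attained {G : Network} {b : ℕ} {ε : ℝ} {f : Bits b → Bits b → ℝ} {r : ℕ}
    (h : distComplexity G ε f = (r : ℕ∞)) :
    ∃ A : DistAlgorithm G b, IsErrorAtMost ε f (A.result r) := by
  rw [distComplexity, iInf_subtype'] at h
  rcases isEmpty_or_nonempty
    {T : ℕ // T ∈ {T : ℕ | ∃ A : DistAlgorithm G b, IsErrorAtMost ε f (A.result T)}} with h0 | h0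
  · rw [iInf_of_empty] at h
    exact absurd h (ENat.top_ne_natCast r)
  · obtain ⟨⟨T, hT⟩, hTr⟩ := ENat.exists_eq_iInf
      (fun T : {T : ℕ // T ∈ {T : ℕ | ∃ A : DistAlgorithm G b, IsErrorAtMost ε f (A.result T)}} =>
        ((T : ℕ) : ℕ∞))
    obtain rfl : T = r := Nat.cast_injective (R := ℕ∞) (hTr.trans h)
    exact hT

theorem ccComplexity_le {b : ℕ} {q ε : ℝ} {f : Bits b → Bits b → ℝ} (P : Protocol b) {c : ℕ}
    (hq : (P.rounds : ℝ) ≤ q) (hf : IsErrorAtMost ε f P.result)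
    (hc : ∀ ω x y, P.bits ω x y ≤ c) : ccComplexity q ε f ≤ c :=
  iInf₂_le c ⟨P, hq, hf, hc⟩

end Main
end BoundedRound

theorem mainTheorem2 (Γ Λ : ℕ) (hΓ : 1 ≤ Γ) (hΛ : 2 ≤ Λ) (κ : ℝ) (hκ : 1 ≤ κ)
    (b : ℕ) (f : Bits b → Bits b → ℝ) (ε : ℝ) (hε : 0 ≤ ε) :
    (∀ r : ℕ, (r : ℝ) ≤ κ * (Λ : ℝ) ^ κ →
      (∃ A : DistAlgorithm (networkG Γ κ Λ) b, IsErrorAtMost ε f (A.result r)) →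
      ∃ P : Protocol b, IsErrorAtMost ε f P.result ∧
        (P.rounds : ℝ) ≤ 8 * (r : ℝ) / (κ * (Λ : ℝ)) ∧
        ∀ ω x y, (P.bits ω x y : ℝ) ≤
          2 * κ * Real.logb 2 ((networkG Γ κ Λ).size : ℝ) * (r : ℝ)) ∧
    (∀ r : ℕ, distComplexity (networkG Γ κ Λ) ε f = (r : ℕ∞) →
      (r : ℝ) ≤ κ * (Λ : ℝ) ^ κ →
      (∃ P : Protocol b, IsErrorAtMost ε f P.result ∧
        (P.rounds : ℝ) ≤ 8 * (r : ℝ) / (κ * (Λ : ℝ)) ∧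
        ∀ ω x y, (P.bits ω x y : ℝ) ≤
          2 * κ * Real.logb 2 ((networkG Γ κ Λ).size : ℝ) * (r : ℝ)) ∧
      ((ccComplexity (8 * (r : ℝ) / (κ * (Λ : ℝ))) ε f : ℕ∞) : ℝ≥0∞) ≤
        ENNReal.ofReal (2 * κ * Real.logb 2 ((networkG Γ κ Λ).size : ℝ) * (r : ℝ))) := by
  have hΛ1 : 1 ≤ Λ := by omega
  have hbits (r : ℕ) :
      ((2 * (⌊κ⌋₊ * Nat.log 2 (networkG Γ κ Λ).size) * r : ℕ) : ℝ) ≤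
        2 * κ * Real.logb 2 ((networkG Γ κ Λ).size : ℝ) * (r : ℝ) := by
    push_cast
    have h1 : (Nat.log 2 (networkG Γ κ Λ).size : ℝ) ≤ Real.logb 2 (networkG Γ κ Λ).size := by
      exact_mod_cast Real.natLog_le_logb (networkG Γ κ Λ).size 2
    have h2 : (⌊κ⌋₊ : ℝ) ≤ κ := Nat.floor_le (by linarith)
    rw [mul_assoc 2 κ]
    gcongr
  have key (r : ℕ) (hr : (r : ℝ) ≤ κ * (Λ : ℝ) ^ κ)
      (hA : ∃ A : DistAlgorithm (networkG Γ κ Λ) b, IsErrorAtMost ε f (A.result r)) :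
      ∃ P : Protocol b, IsErrorAtMost ε f P.result ∧
        (P.rounds : ℝ) ≤ 8 * (r : ℝ) / (κ * (Λ : ℝ)) ∧ ∀ ω x y, P.bits ω x y ≤
          2 * (⌊κ⌋₊ * Nat.log 2 (networkG Γ κ Λ).size) * r := by
    obtain ⟨A, hA⟩ := hA
    obtain ⟨P, hP, h⟩ := exists_protocol_of_algorithm hκ hΛ1 A hr
    exact ⟨P, by rwa [hP], h⟩
  refine ⟨fun r hr hA => ?_, fun r hdist hr => ?_⟩
  · obtain ⟨P, h1, h2, h3⟩ := key r hr hA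
    exact ⟨P, h1, h2, fun ω x y => le_trans (Nat.cast_le.mpr (h3 ω x y)) (hbits r)⟩
  · obtain ⟨P, h1, h2, h3⟩ := key r hr (distComplexity_attained hdist)
    refine ⟨⟨P, h1, h2, fun ω x y => le_trans (Nat.cast_le.mpr (h3 ω x y)) (hbits r)⟩, ?_⟩
    calc ((ccComplexity (8 * (r : ℝ) / (κ * (Λ : ℝ))) ε f : ℕ∞) : ℝ≥0∞)
        ≤ (((2 * (⌊κ⌋₊ * Nat.log 2 (networkG Γ κ Λ).size) * r : ℕ) : ℕ∞) : ℝ≥0∞) :=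
          ENat.toENNReal_le.mpr (ccComplexity_le P h2 h1 h3)
      _ = ENNReal.ofReal ((2 * (⌊κ⌋₊ * Nat.log 2 (networkG Γ κ Λ).size) * r : ℕ) : ℝ) := by
          rw [ENNReal.ofReal_natCast, ENat.toENNReal_coe]
      _ ≤ _ := ENNReal.ofReal_le_ofReal (hbits r)
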